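/- Let $p\in(1,\frac{3+\sqrt5}{2})$, $p\neq 2$, let $q=\frac{p}{p-1}$ and $r=1-\frac{p-1}{q}=1-\frac{(p-1)^2}{p}>0$. Let $(M,d)$ be a locally compact separable metric space and $\mu$ a finite Borel measure on $M$. If $p>2$, assume in addition that $M$ is compact and that $\mu$ is $n$-Ahlfors regular for some $n>0$ with $n(p-2)<1$, i.e. there are $c,C>0$ with $c\,s^n\le\mu(B_s(x))\le C\,s^n$ for all $x\in M$ and $0<s\le\operatorname{diam}M$. Let $\mathcal P_p(M)$ be the set of Borel probability measures on $M$ with finite $p$-th moment, with the $p$-Wasserstein distance $w_p(\nu_0,\nu_1)=\inf_\pi\left(\int d(x,y)^p\,d\pi(x,y)\right)^{1/p}$, where $\pi$ runs over all couplings of $\nu_0$ and $\nu_1$. Put $U_p(x)=\frac{1}{(3-p)(2-p)}(x^{3-p}-x)$, $U_p'(\infty)=\lim_{x\to\infty}U_p(x)/x\in(-\infty,\infty]$, and $$\mathcal U_p(\nu)=\int U_p(\rho)\,d\mu+U_p'(\infty)\,\nu_s(M)\in(-\infty,\infty],\qquad \nu=\rho\mu+\nu_s\in\mathcal P_p(M),$$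 where $\nu=\rho\mu+\nu_s$ is the Lebesgue decomposition of $\nu$ with respect to $\mu$ (with $\infty\cdot0=0$). For a function $f$ on a metric space $(X,d_X)$ and a point $x$ with $f(x)\in\mathbb R$ put $$|D^{\pm}f|(x)=\limsup_{y\to x,\,y\ne x}\frac{[f(y)-f(x)]_{\pm}}{d_X(y,x)},\qquad |Df|(x)=\max\{|D^+f|(x),|D^-f|(x)\},$$ with value $0$ at isolated points. Let $|D^-\mathcal U_p|$ be the descending slope of $\mathcal U_p$ on $(\mathcal P_p(M),w_p)$. Let $\mu_0=\rho\mu\in\mathcal P_p(M)$ with $\mathcal U_p(\mu_0)<\infty$, where $\rho:M\to\mathbb R$ is bounded and Lipschitz with $\rho\ge\varepsilon$ for some constant $\varepsilon>0$. Then $$|D^-\mathcal U_p|^q(\mu_0)\;\le\;\int\frac{|D\rho|^q}{\rho^{p-1}}\,d\mu\;=\;r^{-q}\int|D\rho^r|^q\,d\mu .$$ -/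

import Mathlib

open MeasureTheory Filter Topology
open scoped ENNReal NNReal

noncomputable section

namespace RenyiSlope

/-- The filter of punctured neighbourhoods `y → x`, `y ≠ x`, for the distance `d`. -/
def puncturedNhds {X : Type*} (d : X → X → ℝ≥0∞) (x : X) : Filter X :=
  comap (fun y => d y x) (𝓝 0) ⊓ 𝓟 {x}ᶜ

open Classical in
/-- The ascending slope `|D⁺f|(x) = limsup_{y → x} [f y - f x]₊ / d(y, x)` of an extended real
function with respect to the distance `d`; it is `∞` where `f` is not finite. -/
def ascendingSlope {X : Type*} (d : X → X → ℝ≥0∞) (f : X → EReal) (x : X) : ℝ≥0∞ :=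
  if f x ≠ ⊤ ∧ f x ≠ ⊥ then
    limsup (fun y => (f y - f x).toENNReal / d y x) (puncturedNhds d x)
  else ⊤

open Classical in
/-- The descending slope `|D⁻f|(x) = limsup_{y → x} [f y - f x]₋ / d(y, x)` of an extended real
function with respect to the distance `d`; it is `∞` where `f` is not finite. -/
def descendingSlope {X : Type*} (d : X → X → ℝ≥0∞) (f : X → EReal) (x : X) : ℝ≥0∞ :=
  if f x ≠ ⊤ ∧ f x ≠ ⊥ then
    limsup (fun y => (f x - f y).toENNReal / d y x) (puncturedNhds d x)
  else ⊤

/-- The local Lipschitz constant `|Df| = max {|D⁺f|, |D⁻f|}` of a real function on a metric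
space. -/
def localLip {M : Type*} [MetricSpace M] (f : M → ℝ) (x : M) : ℝ≥0∞ :=
  max (ascendingSlope edist (fun y => (f y : EReal)) x)
    (descendingSlope edist (fun y => (f y : EReal)) x)

/-- The set `𝒫_p(M)` of Borel probability measures with finite `p`-th moment. -/
def WassersteinSpace (M : Type*) [MetricSpace M] [MeasurableSpace M] (p : ℝ) : Type _ :=
  {ν : Measure M // IsProbabilityMeasure ν ∧ ∃ x₀ : M, ∫⁻ x, edist x x₀ ^ p ∂ν < ∞}

/-- The couplings (transport plans) of two measures. -/
def couplings {M : Type*} [MeasurableSpace M] (ν₀ ν₁ : Measure M) : Set (Measure (M × M)) :=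
  {π | π.map Prod.fst = ν₀ ∧ π.map Prod.snd = ν₁}

/-- The `p`-Wasserstein distance `w_p(ν₀, ν₁) = inf_π (∫ d(x, y)^p dπ(x, y))^{1/p}`. -/
def wassersteinDist {M : Type*} [MetricSpace M] [MeasurableSpace M] {p : ℝ}
    (ν₀ ν₁ : WassersteinSpace M p) : ℝ≥0∞ :=
  ⨅ π ∈ couplings ν₀.1 ν₁.1, (∫⁻ z, edist z.1 z.2 ^ p ∂π) ^ (1 / p)

/-- The integral `∫ g⁺ dμ - ∫ g⁻ dμ` with values in the extended reals. -/
def extIntegral {M : Type*} [MeasurableSpace M] (μ : Measure M) (g : M → ℝ) : EReal :=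
  ((∫⁻ x, ENNReal.ofReal (g x) ∂μ : ℝ≥0∞) : EReal)
    - ((∫⁻ x, ENNReal.ofReal (-g x) ∂μ : ℝ≥0∞) : EReal)

/-- `U'(∞) = lim_{x → ∞} U(x) / x`, in the extended reals (for convex `U` the limit exists). -/
def slopeAtInfinity (U : ℝ → ℝ) : EReal :=
  limsup (fun x : ℝ => ((U x / x : ℝ) : EReal)) atTop

/-- The functional `ν ↦ ∫ U(ρ) dμ + U'(∞) ν_s(M)`, where `ν = ρ μ + ν_s` is the Lebesgue
decomposition of `ν` with respect to `μ`. -/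
def entropyFunctional {M : Type*} [MeasurableSpace M] (U : ℝ → ℝ) (μ ν : Measure M) : EReal :=
  extIntegral μ (fun x => U (ν.rnDeriv μ x).toReal)
    + slopeAtInfinity U * ((ν.singularPart μ Set.univ : ℝ≥0∞) : EReal)

/-- `U_p(x) = (x^{3-p} - x) / ((3-p)(2-p))`. -/
def renyiFun (p x : ℝ) : ℝ := 1 / ((3 - p) * (2 - p)) * (x ^ (3 - p) - x)

/-- The Renyi entropy functional `𝒰_p` on `𝒫_p(M)` with reference measure `μ`. -/
def renyiEntropy {M : Type*} [MetricSpace M] [MeasurableSpace M] (p : ℝ) (μ : Measure M)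
    (ν : WassersteinSpace M p) : EReal :=
  entropyFunctional (renyiFun p) μ ν.1

/-- `n`-Ahlfors regularity: `c s^n ≤ μ(B_s(x)) ≤ C s^n` for all points `x` and all radii
`0 < s ≤ diam M`. -/
def IsAhlforsRegular {M : Type*} [MetricSpace M] [MeasurableSpace M] (μ : Measure M)
    (n : ℝ) : Prop :=
  ∃ c C : ℝ, 0 < c ∧ 0 < C ∧ ∀ (x : M) (s : ℝ), 0 < s → s ≤ Metric.diam (Set.univ : Set M) →
    ENNReal.ofReal (c * s ^ n) ≤ μ (Metric.ball x s) ∧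
      μ (Metric.ball x s) ≤ ENNReal.ofReal (C * s ^ n)

end RenyiSlope

end

noncomputable section

namespace RenyiSlope

/-! Convexity of `U_p` makes `g = U_p'(ρ)` a subgradient of the entropy at `μ₀`: the entropy drops
by at most `∫ g dμ₀ - ∫ g dν` (`entropyFunctional_ge`; the singular part of `ν` is paid for by the
slope at infinity). Integrating `g(y) - g(x)` against a coupling and applying Hölder bounds this
drop by the transport cost times an `L^q` norm of descending difference quotients of `g`
(`ofReal_integral_sub_le`). Pairs at distance at least `δ` carry little mass by Markov, so `ν → μ₀`
and then `δ → 0` leave the local slope of `g` (`descendingSlope_rpow_le`). Since `U_p''(t) =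
t^(1-p)`, the chain rule and `pq = p + q` turn `|Dg|^q ρ` into `|Dρ|^q / ρ^(p-1)`. The final
equality is the chain rule for `t ↦ t^r`. -/

/-! ### Local Lipschitz constants and the chain rule. -/

theorem puncturedNhds_edist_le_nhds {M : Type*} [MetricSpace M] (x : M) :
    puncturedNhds edist x ≤ 𝓝 x := by
  have h : Tendsto id (puncturedNhds edist x) (𝓝 x) :=
    tendsto_iff_edist_tendsto_0.2 (tendsto_comap.mono_left inf_le_left)
  simpa [Tendsto] using h

theorem localLip_eq_limsup {M : Type*} [MetricSpace M] (f : M → ℝ) (x : M) :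
    localLip f x = limsup (fun y => edist (f y) (f x) / edist y x) (puncturedNhds edist x) := by
  have hmax : ∀ y, edist (f y) (f x) / edist y x =
      max (((f y : EReal) - f x).toENNReal / edist y x)
        (((f x : EReal) - f y).toENNReal / edist y x) := by
    intro y
    have hmono : Monotone fun a : ℝ≥0∞ => a / edist y x := fun a b h => ENNReal.div_le_div_right h _
    rw [← hmono.map_max, ← EReal.coe_sub, ← EReal.coe_sub, EReal.real_coe_toENNReal,
      EReal.real_coe_toENNReal, edist_dist, Real.dist_eq, abs_eq_max_neg, neg_sub,
      ENNReal.ofReal_max]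
  simp_rw [hmax]
  rw [limsup_max]
  simp [localLip, ascendingSlope, descendingSlope]

theorem localLip_comp_le {M : Type*} [MetricSpace M] {f : M → ℝ} {φ : ℝ → ℝ} {c : ℝ} {x : M}
    (hf : ContinuousAt f x) (hφ : HasDerivAt φ c (f x)) (hc : 0 < c) :
    localLip (fun y => φ (f y)) x ≤ ENNReal.ofReal c * localLip f x := by
  -- The slack `b - c` absorbs the first-order error; in the limit `b → c`, positivity of `c`
  -- excludes `0 · ∞`.
  have key : ∀ b, c < b →
      localLip (fun y => φ (f y)) x ≤ ENNReal.ofReal b * localLip f x := by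
    intro b hb
    rw [localLip_eq_limsup, localLip_eq_limsup, ← ENNReal.limsup_const_mul_of_ne_top
      ENNReal.ofReal_ne_top]
    refine limsup_le_limsup ?_
    have hlo := (hasDerivAt_iff_isLittleO.1 hφ).def (sub_pos.2 hb)
    filter_upwards [(hf.mono_left (puncturedNhds_edist_le_nhds x)).eventually hlo] with y hy
    rw [← mul_div_assoc]
    refine ENNReal.div_le_div_right ?_ _
    rw [edist_dist, edist_dist, ← ENNReal.ofReal_mul (hc.trans hb).le, Real.dist_eq, Real.dist_eq]
    refine ENNReal.ofReal_le_ofReal ?_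
    simp only [smul_eq_mul, Real.norm_eq_abs] at hy
    calc |φ (f y) - φ (f x)|
        = |(φ (f y) - φ (f x) - (f y - f x) * c) + (f y - f x) * c| := by ring_nf
      _ ≤ |φ (f y) - φ (f x) - (f y - f x) * c| + |(f y - f x) * c| := abs_add_le _ _
      _ ≤ (b - c) * |f y - f x| + |f y - f x| * c := by
          rw [abs_mul _ c, abs_of_pos hc]; gcongr
      _ = b * |f y - f x| := by ring
  have ht : Tendsto (fun b => ENNReal.ofReal b * localLip f x) (𝓝[>] c)
      (𝓝 (ENNReal.ofReal c * localLip f x)) :=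
    ENNReal.Tendsto.mul_const
      ((ENNReal.continuous_ofReal.tendsto c).mono_left nhdsWithin_le_nhds)
      (Or.inl (by simpa using hc))
  refine ge_of_tendsto ht ?_
  filter_upwards [self_mem_nhdsWithin] with b hb using key b hb

theorem localLip_rpow {M : Type*} [MetricSpace M] {f : M → ℝ} {r : ℝ} (hr : 0 < r) {x : M}
    (hf : Continuous f) (hpos : ∀ y, 0 < f y) :
    localLip (fun y => f y ^ r) x = ENNReal.ofReal (r * f x ^ (r - 1)) * localLip f x := by
  have hx := hpos x
  have hc : 0 < r * f x ^ (r - 1) := by positivity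
  refine le_antisymm (localLip_comp_le (φ := fun t => t ^ r) hf.continuousAt
    (Real.hasDerivAt_rpow_const (Or.inl hx.ne')) hc) ?_
  -- The reverse bound is the chain-rule inequality for the inverse power.
  have hinv : f = fun y => (f y ^ r) ^ (r⁻¹) := by
    ext y; rw [← Real.rpow_mul (hpos y).le, mul_inv_cancel₀ hr.ne', Real.rpow_one]
  have hd : HasDerivAt (fun t : ℝ => t ^ r⁻¹) (r * f x ^ (r - 1))⁻¹ (f x ^ r) := by
    convert! Real.hasDerivAt_rpow_const (p := r⁻¹) (Or.inl (Real.rpow_pos_of_pos hx r).ne') using 1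
    rw [mul_inv, ← Real.rpow_mul hx.le, ← Real.rpow_neg hx.le]
    congr 2
    field_simp
    ring
  have hcont : ContinuousAt (fun y => f y ^ r) x :=
    hf.continuousAt.rpow_const (Or.inl hx.ne')
  have h : localLip f x ≤
      ENNReal.ofReal (r * f x ^ (r - 1))⁻¹ * localLip (fun y => f y ^ r) x :=
    calc localLip f x = localLip (fun y => (f y ^ r) ^ r⁻¹) x := congrArg (localLip · x) hinv
      _ ≤ _ := localLip_comp_le (f := fun y => f y ^ r) (φ := fun t => t ^ r⁻¹) hcont hd
        (inv_pos.2 hc)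
  calc ENNReal.ofReal (r * f x ^ (r - 1)) * localLip f x
      ≤ ENNReal.ofReal (r * f x ^ (r - 1)) *
        (ENNReal.ofReal (r * f x ^ (r - 1))⁻¹ * localLip (fun y => f y ^ r) x) := by gcongr
    _ = _ := by
      rw [← mul_assoc, ← ENNReal.ofReal_mul hc.le, mul_inv_cancel₀ hc.ne', ENNReal.ofReal_one,
        one_mul]

/-- Pointwise chain rule; the choice of `r` is exactly `(r - 1) q = -(p - 1)`. -/
theorem lintegral_localLip_rpow {M : Type*} [MetricSpace M] [MeasurableSpace M] (μ : Measure M)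
    {p q r : ℝ} (hpq : p.HolderConjugate q) (hr : r = 1 - (p - 1) / q) (hr0 : 0 < r)
    {f : M → ℝ} (hf : Continuous f) (hpos : ∀ y, 0 < f y) :
    ∫⁻ x, localLip f x ^ q / ENNReal.ofReal (f x ^ (p - 1)) ∂μ
      = ENNReal.ofReal (r ^ (-q)) * ∫⁻ x, localLip (fun y => f y ^ r) x ^ q ∂μ := by
  have hq := hpq.symm.pos
  rw [← lintegral_const_mul' _ _ ENNReal.ofReal_ne_top]
  refine lintegral_congr fun x => ?_
  have hx := hpos x
  rw [localLip_rpow hr0 hf hpos, ENNReal.mul_rpow_of_nonneg _ _ hq.le, ← mul_assoc,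
    ENNReal.ofReal_rpow_of_pos (by positivity), ← ENNReal.ofReal_mul (by positivity), mul_comm,
    div_eq_mul_inv, ← ENNReal.ofReal_inv_of_pos (by positivity)]
  congr 2
  rw [Real.mul_rpow hr0.le (by positivity), ← mul_assoc, ← Real.rpow_add hr0, neg_add_cancel,
    Real.rpow_zero, one_mul, ← Real.rpow_mul hx.le, ← Real.rpow_neg hx.le]
  congr 1
  rw [hr]; field_simp; ring

/-! ### Descending difference quotients at a fixed scale. -/

/-- The supremum of the descending difference quotients of `f` at `x` over the points at distance
less than `δ` from `x`. -/
def localDescent {M : Type*} [MetricSpace M] (f : M → ℝ) (δ : ℝ≥0∞) (x : M) : ℝ≥0∞ :=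
  ⨆ y, ⨆ (_ : y ≠ x ∧ edist y x < δ), ENNReal.ofReal (f x - f y) / edist y x

theorem le_localDescent {M : Type*} [MetricSpace M] (f : M → ℝ) {δ : ℝ≥0∞} {x y : M}
    (h : edist y x < δ) : ENNReal.ofReal (f x - f y) / edist y x ≤ localDescent f δ x := by
  rcases eq_or_ne y x with rfl | hne
  · simp
  · exact le_iSup₂_of_le (f := fun y _ => ENNReal.ofReal (f x - f y) / edist y x) y ⟨hne, h⟩ le_rfl

theorem localDescent_mono {M : Type*} [MetricSpace M] (f : M → ℝ) (x : M) :
    Monotone fun δ => localDescent f δ x := fun _ _ h =>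
  iSup₂_le fun _ hy => le_localDescent f (hy.2.trans_le h)

theorem ofReal_sub_div_edist_le {M : Type*} [MetricSpace M] {f : M → ℝ} {L : ℝ≥0}
    (hf : LipschitzWith L f) (x y : M) : ENNReal.ofReal (f x - f y) / edist y x ≤ L := by
  refine ENNReal.div_le_of_le_mul ?_
  calc ENNReal.ofReal (f x - f y) ≤ ENNReal.ofReal |f x - f y| :=
        ENNReal.ofReal_le_ofReal (le_abs_self _)
    _ = edist (f x) (f y) := by rw [edist_dist, Real.dist_eq]
    _ ≤ L * edist y x := by rw [edist_comm y x]; exact hf x y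

theorem localDescent_le {M : Type*} [MetricSpace M] {f : M → ℝ} {L : ℝ≥0}
    (hf : LipschitzWith L f) (δ : ℝ≥0∞) (x : M) : localDescent f δ x ≤ L :=
  iSup₂_le fun y _ => ofReal_sub_div_edist_le hf x y

/-- A competitor `y` for `x` stays admissible, with nearly the same quotient, for points near `x`;
hence lower semicontinuity. -/
theorem measurable_localDescent {M : Type*} [MetricSpace M] [MeasurableSpace M] [BorelSpace M]
    {f : M → ℝ} (hf : Continuous f) (δ : ℝ≥0∞) : Measurable (localDescent f δ) := by
  refine LowerSemicontinuous.measurable fun x a ha => ?_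
  simp only [localDescent, lt_iSup_iff] at ha
  obtain ⟨y, ⟨hne, hδ⟩, hy⟩ := ha
  have hc : ContinuousAt (fun x => ENNReal.ofReal (f x - f y) / edist y x) x :=
    ENNReal.Tendsto.div
      ((ENNReal.continuous_ofReal.comp (hf.sub continuous_const)).tendsto x)
      (Or.inr (by simpa using hne))
      ((continuous_const.edist continuous_id).tendsto x) (Or.inr ENNReal.ofReal_ne_top)
  filter_upwards [hc.eventually (lt_mem_nhds hy), isOpen_ne.mem_nhds hne.symm,
    (continuous_const.edist continuous_id).continuousAt.eventually (gt_mem_nhds hδ)]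
    with z hz _ hzδ
  exact hz.trans_le (le_localDescent f hzδ)

theorem iInf_localDescent_le {M : Type*} [MetricSpace M] (f : M → ℝ) (x : M) :
    ⨅ n : ℕ, localDescent f ((n : ℝ≥0∞) + 1)⁻¹ x ≤ localLip f x := by
  refine le_trans ?_ (le_max_right _ _)
  simp only [descendingSlope, ne_eq, EReal.coe_ne_top, not_false_eq_true, EReal.coe_ne_bot,
    and_self, if_true]
  rw [limsup_eq_iInf_iSup]
  refine le_iInf₂ fun s hs => ?_
  rw [puncturedNhds, mem_inf_principal, mem_comap] at hs
  obtain ⟨t, ht, hts⟩ := hs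
  obtain ⟨δ, hδ, hδt⟩ := (ENNReal.nhds_zero_basis.mem_iff).1 ht
  obtain ⟨n, hn⟩ := ENNReal.exists_inv_nat_lt hδ.ne'
  refine iInf_le_of_le n (iSup₂_le fun y hy => ?_)
  have hys : y ∈ s := hts (hδt (hy.2.trans (lt_of_le_of_lt
    (ENNReal.inv_le_inv.2 le_self_add) hn))) hy.1
  refine le_iSup₂_of_le (f := fun y _ => ((f x : EReal) - f y).toENNReal / edist y x) y hys ?_
  rw [← EReal.coe_sub, EReal.real_coe_toENNReal]

/-! ### Subgradient inequality for convex entropy functionals. -/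

theorem extIntegral_eq_integral {M : Type*} [MeasurableSpace M] {μ : Measure M} {g : M → ℝ}
    (hg : Integrable g μ) : extIntegral μ g = ((∫ x, g x ∂μ : ℝ) : EReal) := by
  have h1 : ∫⁻ x, ENNReal.ofReal (g x) ∂μ ≠ ∞ := hg.lintegral_lt_top.ne
  have h2 : ∫⁻ x, ENNReal.ofReal (-g x) ∂μ ≠ ∞ := hg.neg.lintegral_lt_top.ne
  rw [extIntegral, integral_eq_lintegral_pos_part_sub_lintegral_neg_part hg, EReal.coe_sub,
    EReal.coe_ennreal_toReal h1, EReal.coe_ennreal_toReal h2]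

theorem extIntegral_mono_ae {M : Type*} [MeasurableSpace M] {μ : Measure M} {g h : M → ℝ}
    (hgh : ∀ᵐ x ∂μ, g x ≤ h x) : extIntegral μ g ≤ extIntegral μ h := by
  refine EReal.sub_le_sub ?_ ?_
  · exact EReal.coe_ennreal_le_coe_ennreal_iff.2
      (lintegral_mono_ae (hgh.mono fun x hx => ENNReal.ofReal_le_ofReal hx))
  · exact EReal.coe_ennreal_le_coe_ennreal_iff.2
      (lintegral_mono_ae (hgh.mono fun x hx => ENNReal.ofReal_le_ofReal (neg_le_neg hx)))

/-- A supporting slope of `U` is at most the slope of `U` at infinity. -/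
theorem le_slopeAtInfinity {U : ℝ → ℝ} {a b : ℝ} (h : ∀ x, 0 ≤ x → a + b * x ≤ U x) :
    (b : EReal) ≤ slopeAtInfinity U := by
  have ht : Tendsto (fun x : ℝ => ((a / x + b : ℝ) : EReal)) atTop (𝓝 (b : EReal)) := by
    refine (continuous_coe_real_ereal.tendsto b).comp ?_
    simpa using (tendsto_const_nhds (x := a)).div_atTop tendsto_id |>.add_const b
  rw [← ht.limsup_eq]
  refine limsup_le_limsup ?_
  filter_upwards [eventually_gt_atTop 0] with x hx
  rw [EReal.coe_le_coe_iff, le_div_iff₀ hx, add_mul, div_mul_cancel₀ _ hx.ne']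
  exact h x hx.le

/-- The subgradient inequality for the functional `ν ↦ ∫ U(ρ) dμ + U'(∞) ν_s(M)` at a measure
`ρ μ`. -/
theorem entropyFunctional_ge {M : Type*} [MeasurableSpace M] {U V : ℝ → ℝ} {μ ν : Measure M}
    [IsFiniteMeasure μ] [IsFiniteMeasure ν] {ρ : M → ℝ} (hρ : Measurable ρ)
    (hV : Measurable V) (hU : Measurable U)
    {ε C : ℝ} (hε : 0 < ε) (hρε : ∀ x, ε ≤ ρ x) (hρC : ∀ x, ρ x ≤ C)
    (hUV : ∀ t s, 0 < t → 0 ≤ s → U t + V t * (s - t) ≤ U s)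
    (hmono : MonotoneOn V (Set.Ioi 0)) :
    Integrable (fun x => V (ρ x)) ν ∧ Integrable (fun x => U (ρ x)) μ ∧
    (((∫ x, U (ρ x) ∂μ) + (∫ x, V (ρ x) ∂ν)
      - ∫ x, V (ρ x) ∂(μ.withDensity fun x => ENNReal.ofReal (ρ x)) : ℝ) : EReal)
      ≤ entropyFunctional U μ ν := by
  have hpos : ∀ x, 0 < ρ x := fun x => hε.trans_le (hρε x)
  -- `max C ε` is a positive upper bound of `ρ` even if `M` is empty.
  set B := max |V ε| |V (max C ε)| with hB
  have hCpos : 0 < max C ε := lt_max_of_lt_right hε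
  have hVB : ∀ x, V (ρ x) ≤ V (max C ε) := fun x =>
    hmono (hpos x) hCpos ((hρC x).trans (le_max_left _ _))
  have hVbdd : ∀ x, ‖V (ρ x)‖ ≤ B := fun x =>
    abs_le_max_abs_abs (hmono hε (hpos x) (hρε x)) (hVB x)
  have hVm : Measurable fun x => V (ρ x) := hV.comp hρ
  have hVint : ∀ (κ : Measure M) [IsFiniteMeasure κ], Integrable (fun x => V (ρ x)) κ :=
    fun κ _ => Integrable.of_bound hVm.aestronglyMeasurable B (ae_of_all _ hVbdd)
  have hρint : Integrable ρ μ := Integrable.of_bound hρ.aestronglyMeasurable C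
    (ae_of_all _ fun x => by rw [Real.norm_of_nonneg (hpos x).le]; exact hρC x)
  have hσint : Integrable (fun x => (ν.rnDeriv μ x).toReal) μ := Measure.integrable_toReal_rnDeriv
  have hVρ : Integrable (fun x => V (ρ x) * ρ x) μ :=
    hρint.bdd_mul hVm.aestronglyMeasurable (ae_of_all _ hVbdd)
  have hVσ : Integrable (fun x => V (ρ x) * (ν.rnDeriv μ x).toReal) μ :=
    hσint.bdd_mul hVm.aestronglyMeasurable (ae_of_all _ hVbdd)
  have hUint : Integrable (fun x => U (ρ x)) μ := by
    -- `U(ρ)` lies between the tangent at `1` evaluated at `ρ` and the bound from the tangent at `ρ`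
    -- evaluated at `1`.
    have hlow : Integrable (fun x => U 1 + V 1 * (ρ x - 1)) μ := by fun_prop
    have hhigh : Integrable (fun x => U 1 - V (ρ x) * (1 - ρ x)) μ := by
      have : (fun x => U 1 - V (ρ x) * (1 - ρ x)) = fun x => U 1 - V (ρ x) + V (ρ x) * ρ x := by
        ext x; ring
      rw [this]
      exact ((integrable_const _).sub (hVint μ)).add hVρ
    refine (integrable_of_le_of_le (hU.comp hρ).aestronglyMeasurable
      (ae_of_all _ fun x => ?_) (ae_of_all _ fun x => ?_) hlow hhigh)
    · exact hUV 1 (ρ x) one_pos (hpos x).le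
    · have := hUV (ρ x) 1 (hpos x) zero_le_one
      linarith
  refine ⟨hVint ν, hUint, ?_⟩
  have h0 : ∫ x, V (ρ x) ∂(μ.withDensity fun x => ENNReal.ofReal (ρ x))
      = ∫ x, V (ρ x) * ρ x ∂μ := by
    rw [integral_withDensity_eq_integral_toReal_smul hρ.ennreal_ofReal
      (ae_of_all _ fun _ => ENNReal.ofReal_lt_top)]
    refine integral_congr_ae (ae_of_all _ fun x => ?_)
    simp only [smul_eq_mul, ENNReal.toReal_ofReal (hpos x).le, mul_comm]
  have h1 : ∫ x, V (ρ x) ∂ν = ∫ x, V (ρ x) ∂(ν.singularPart μ)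
      + ∫ x, V (ρ x) * (ν.rnDeriv μ x).toReal ∂μ := by
    conv_lhs => rw [Measure.haveLebesgueDecomposition_add ν μ]
    rw [integral_add_measure (hVint _) (hVint _),
      integral_withDensity_eq_integral_toReal_smul (Measure.measurable_rnDeriv _ _)
      (Measure.rnDeriv_lt_top _ _)]
    simp only [smul_eq_mul, mul_comm]
  have h2 : ((∫ x, (U (ρ x) + V (ρ x) * ((ν.rnDeriv μ x).toReal - ρ x)) ∂μ : ℝ) : EReal)
      ≤ extIntegral μ fun x => U (ν.rnDeriv μ x).toReal := by
    rw [← extIntegral_eq_integral]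
    · exact extIntegral_mono_ae (ae_of_all _ fun x => hUV _ _ (hpos x) ENNReal.toReal_nonneg)
    · simp only [mul_sub]
      exact hUint.add (hVσ.sub hVρ)
  have h3 : ((∫ x, V (ρ x) ∂(ν.singularPart μ) : ℝ) : EReal)
      ≤ slopeAtInfinity U * ((ν.singularPart μ Set.univ : ℝ≥0∞) : EReal) := by
    calc ((∫ x, V (ρ x) ∂(ν.singularPart μ) : ℝ) : EReal)
        ≤ ((V (max C ε) * (ν.singularPart μ Set.univ).toReal : ℝ) : EReal) := by
          rw [EReal.coe_le_coe_iff]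
          refine (integral_mono (hVint _) (integrable_const _) hVB).trans_eq ?_
          simp [Measure.real, mul_comm]
      _ = (V (max C ε) : EReal) * ((ν.singularPart μ Set.univ : ℝ≥0∞) : EReal) := by
          rw [EReal.coe_mul, EReal.coe_ennreal_toReal (measure_ne_top _ _)]
      _ ≤ _ := by
          refine mul_le_mul_of_nonneg_right ?_ (EReal.coe_ennreal_nonneg _)
          refine le_slopeAtInfinity (a := U (max C ε) - V (max C ε) * max C ε) fun x hx => ?_
          have := hUV (max C ε) x hCpos hx
          linarith
  refine le_trans (le_of_eq ?_) (add_le_add h2 h3)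
  rw [← EReal.coe_add, h0, h1]
  congr 1
  simp only [mul_sub]
  have h4 : Integrable (fun x => V (ρ x) * (ν.rnDeriv μ x).toReal - V (ρ x) * ρ x) μ :=
    hVσ.sub hVρ
  rw [integral_add hUint h4, integral_sub hVσ hVρ]
  ring

theorem entropyFunctional_withDensity {M : Type*} [MeasurableSpace M] {U : ℝ → ℝ} {μ : Measure M}
    [SigmaFinite μ] {ρ : M → ℝ} (hρ : Measurable ρ) (hpos : ∀ x, 0 ≤ ρ x)
    (hint : Integrable (fun x => U (ρ x)) μ) :
    entropyFunctional U μ (μ.withDensity fun x => ENNReal.ofReal (ρ x))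
      = ((∫ x, U (ρ x) ∂μ : ℝ) : EReal) := by
  have h := Measure.rnDeriv_withDensity μ hρ.ennreal_ofReal
  have h' : extIntegral μ (fun x =>
      U ((μ.withDensity fun x => ENNReal.ofReal (ρ x)).rnDeriv μ x).toReal)
      = extIntegral μ fun x => U (ρ x) := by
    refine le_antisymm (extIntegral_mono_ae ?_) (extIntegral_mono_ae ?_) <;>
    · filter_upwards [h] with x hx
      rw [hx, ENNReal.toReal_ofReal (hpos x)]
  rw [entropyFunctional, h', Measure.singularPart_withDensity, extIntegral_eq_integral hint]
  simp

/-! ### Convexity of the Rényi integrand. -/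

/-- The derivative of `renyiFun`. -/
def renyiDeriv (p x : ℝ) : ℝ := 1 / ((3 - p) * (2 - p)) * ((3 - p) * x ^ (2 - p) - 1)

theorem hasDerivAt_renyiDeriv {p : ℝ} (hp3 : p < 3) (hp2 : p ≠ 2) {x : ℝ} (hx : 0 < x) :
    HasDerivAt (renyiDeriv p) (x ^ (1 - p)) x := by
  have h := (((Real.hasDerivAt_rpow_const (p := 2 - p) (Or.inl hx.ne')).const_mul (3 - p)).sub_const
    1).const_mul (1 / ((3 - p) * (2 - p)))
  convert! h using 1
  have h3 : 3 - p ≠ 0 := by linarith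
  have h2 : 2 - p ≠ 0 := fun h => hp2 (by linarith)
  rw [show 2 - p - 1 = 1 - p by ring]
  field_simp

/-- Scaling by `t` reduces this to Bernoulli's inequality with exponent `3 - p`, whose direction
flips at `p = 2` together with the sign of `2 - p`. -/
theorem renyiFun_ge_tangent {p : ℝ} (hp3 : p < 3) (hp2 : p ≠ 2) {t s : ℝ}
    (ht : 0 < t) (hs : 0 ≤ s) : renyiFun p t + renyiDeriv p t * (s - t) ≤ renyiFun p s := by
  have hst : -1 ≤ s / t - 1 := by have : 0 ≤ s / t := by positivity
                                  linarith
  have hscale : s ^ (3 - p) = t ^ (3 - p) * (1 + (s / t - 1)) ^ (3 - p) := by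
    rw [add_sub_cancel, ← Real.mul_rpow ht.le (by positivity), mul_div_cancel₀ _ ht.ne']
  have hsplit : t ^ (3 - p) = t ^ (2 - p) * t := by
    rw [← Real.rpow_add_one ht.ne']; congr 1; ring
  have hdiff : renyiFun p s - (renyiFun p t + renyiDeriv p t * (s - t)) =
      t ^ (3 - p) * (((1 + (s / t - 1)) ^ (3 - p) - (1 + (3 - p) * (s / t - 1))) / (2 - p))
        / (3 - p) := by
    have h3 : 3 - p ≠ 0 := by linarith
    have h2 : 2 - p ≠ 0 := fun h => hp2 (by linarith)
    rw [renyiFun, renyiFun, renyiDeriv, hscale, hsplit]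
    field_simp
    ring
  have hq : 0 ≤ ((1 + (s / t - 1)) ^ (3 - p) - (1 + (3 - p) * (s / t - 1))) / (2 - p) := by
    rcases lt_or_gt_of_ne hp2 with h | h
    · exact div_nonneg (sub_nonneg.2 (one_add_mul_self_le_rpow_one_add hst (by linarith)))
        (by linarith)
    · exact div_nonneg_of_nonpos (sub_nonpos.2 (rpow_one_add_le_one_add_mul_self hst
        (by linarith) (by linarith))) (by linarith)
  have : 0 ≤ renyiFun p s - (renyiFun p t + renyiDeriv p t * (s - t)) := by
    rw [hdiff]
    have : 0 < 3 - p := by linarith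
    positivity
  linarith

theorem monotoneOn_renyiDeriv {p : ℝ} (hp3 : p < 3) (hp2 : p ≠ 2) :
    MonotoneOn (renyiDeriv p) (Set.Ioi 0) := by
  intro a ha b hb hab
  rcases hab.eq_or_lt with rfl | hab
  · rfl
  have h1 := renyiFun_ge_tangent hp3 hp2 ha (le_of_lt hb)
  have h2 := renyiFun_ge_tangent hp3 hp2 hb (le_of_lt ha)
  exact le_of_mul_le_mul_right (by linarith) (sub_pos.2 hab)

theorem lipschitzOnWith_renyiDeriv {p : ℝ} (hp1 : 1 < p) (hp3 : p < 3) (hp2 : p ≠ 2) {ε : ℝ}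
    (hε : 0 < ε) : LipschitzOnWith (ε ^ (1 - p)).toNNReal (renyiDeriv p) (Set.Ici ε) := by
  refine (convex_Ici ε).lipschitzOnWith_of_nnnorm_hasDerivWithin_le
    (fun x hx => (hasDerivAt_renyiDeriv hp3 hp2 (hε.trans_le hx)).hasDerivWithinAt) fun x hx => ?_
  have hx0 : 0 < x := hε.trans_le hx
  rw [← NNReal.coe_le_coe, coe_nnnorm, Real.norm_of_nonneg (by positivity),
    Real.coe_toNNReal _ (by positivity)]
  exact Real.rpow_le_rpow_of_nonpos hε hx (by linarith)

theorem measurable_renyiFun (p : ℝ) : Measurable (renyiFun p) := by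
  unfold renyiFun; fun_prop

theorem measurable_renyiDeriv (p : ℝ) : Measurable (renyiDeriv p) := by
  unfold renyiDeriv; fun_prop

/-! ### Couplings and the slope estimate. -/

theorem measure_edist_ge_le_lintegral_div {M : Type*} [MetricSpace M] [MeasurableSpace M]
    [SecondCountableTopology M] [BorelSpace M] {p : ℝ} (hp : 0 < p) (π : Measure (M × M))
    {δ : ℝ≥0∞} (hδ0 : δ ≠ 0) (hδ : δ ≠ ∞) :
    π {z | δ ≤ edist z.1 z.2} ≤ (∫⁻ z, edist z.1 z.2 ^ p ∂π) / δ ^ p := by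
  have h : {z : M × M | δ ≤ edist z.1 z.2} = {z | δ ^ p ≤ edist z.1 z.2 ^ p} := by
    ext z; exact (ENNReal.rpow_le_rpow_iff hp).symm
  rw [h]
  refine meas_ge_le_lintegral_div (by fun_prop) ?_ ?_
  · exact (ENNReal.rpow_pos (pos_iff_ne_zero.2 hδ0) hδ).ne'
  · exact ENNReal.rpow_ne_top_of_nonneg hp.le hδ

theorem ofReal_integral_sub_le {M : Type*} [MetricSpace M] [MeasurableSpace M]
    [SecondCountableTopology M] [BorelSpace M] {p q : ℝ} (hpq : p.HolderConjugate q)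
    {ν ν₀ : Measure M} {π : Measure (M × M)} (hπ : π ∈ couplings ν ν₀)
    {g : M → ℝ} {L : ℝ≥0} (hg : LipschitzWith L g) (hν : Integrable g ν) (hν₀ : Integrable g ν₀)
    {δ : ℝ≥0∞} (hδ0 : δ ≠ 0) (hδ : δ ≠ ∞) :
    ENNReal.ofReal (∫ x, g x ∂ν₀ - ∫ x, g x ∂ν) ≤
      (∫⁻ x, localDescent g δ x ^ q ∂ν₀
        + (L : ℝ≥0∞) ^ q * ((∫⁻ z, edist z.1 z.2 ^ p ∂π) / δ ^ p)) ^ (1 / q)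
      * (∫⁻ z, edist z.1 z.2 ^ p ∂π) ^ (1 / p) := by
  obtain ⟨h1, h2⟩ := hπ
  have hgc := hg.continuous
  have hgm : Measurable g := hgc.measurable
  have hi1 : Integrable (fun z : M × M => g z.1) π := by
    rw [← h1] at hν; exact hν.comp_measurable measurable_fst
  have hi2 : Integrable (fun z : M × M => g z.2) π := by
    rw [← h2] at hν₀; exact hν₀.comp_measurable measurable_snd
  have e1 : ∫ x, g x ∂ν = ∫ z, g z.1 ∂π := by
    rw [← h1, integral_map measurable_fst.aemeasurable hgm.aestronglyMeasurable]
  have e2 : ∫ x, g x ∂ν₀ = ∫ z, g z.2 ∂π := by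
    rw [← h2, integral_map measurable_snd.aemeasurable hgm.aestronglyMeasurable]
  set F : M × M → ℝ≥0∞ := fun z => ENNReal.ofReal (g z.2 - g z.1) / edist z.1 z.2 with hF
  have hFm : Measurable F := by fun_prop
  have hS : MeasurableSet {z : M × M | δ ≤ edist z.1 z.2} :=
    measurableSet_le measurable_const (by fun_prop)
  -- Near pairs are controlled by the local quotient at the second point, far pairs only by the
  -- global constant `L`.
  have hFpow : ∀ z, F z ^ q ≤ localDescent g δ z.2 ^ q
      + {z : M × M | δ ≤ edist z.1 z.2}.indicator (fun _ => (L : ℝ≥0∞) ^ q) z := by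
    intro z
    by_cases hz : δ ≤ edist z.1 z.2
    · rw [Set.indicator_of_mem (by exact hz)]
      exact le_add_left (ENNReal.rpow_le_rpow (ofReal_sub_div_edist_le hg _ _) hpq.symm.nonneg)
    · exact le_add_right (ENNReal.rpow_le_rpow (le_localDescent g (not_le.1 hz)) hpq.symm.nonneg)
  have hFint : ∫⁻ z, F z ^ q ∂π ≤ ∫⁻ x, localDescent g δ x ^ q ∂ν₀
      + (L : ℝ≥0∞) ^ q * ((∫⁻ z, edist z.1 z.2 ^ p ∂π) / δ ^ p) := by
    have hm : Measurable fun x => localDescent g δ x ^ q :=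
      (measurable_localDescent hgc δ).pow_const q
    calc ∫⁻ z, F z ^ q ∂π ≤ _ := lintegral_mono hFpow
      _ = ∫⁻ x, localDescent g δ x ^ q ∂ν₀
          + (L : ℝ≥0∞) ^ q * π {z | δ ≤ edist z.1 z.2} := by
        have hm2 : Measurable fun z : M × M => localDescent g δ z.2 ^ q := hm.comp measurable_snd
        rw [lintegral_add_left hm2, lintegral_indicator_const hS, ← h2,
          lintegral_map hm measurable_snd]
      _ ≤ _ := by gcongr; exact measure_edist_ge_le_lintegral_div hpq.pos π hδ0 hδ
  calc ENNReal.ofReal (∫ x, g x ∂ν₀ - ∫ x, g x ∂ν)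
      = ENNReal.ofReal (∫ z, (g z.2 - g z.1) ∂π) := by rw [e1, e2, integral_sub hi2 hi1]
    _ ≤ ∫⁻ z, ENNReal.ofReal (g z.2 - g z.1) ∂π := by
        have hi : Integrable (fun z : M × M => g z.2 - g z.1) π := hi2.sub hi1
        rw [integral_eq_lintegral_pos_part_sub_lintegral_neg_part hi]
        refine ENNReal.ofReal_le_of_le_toReal (sub_le_self _ ENNReal.toReal_nonneg)
    _ ≤ ∫⁻ z, (F * fun z : M × M => edist z.1 z.2) z ∂π := by
        refine lintegral_mono fun z => ?_
        simp only [Pi.mul_apply, hF]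
        rcases eq_or_ne z.1 z.2 with h | h
        · simp [h]
        · rw [ENNReal.div_mul_cancel (edist_pos.2 h).ne' (edist_ne_top _ _)]
    _ ≤ (∫⁻ z, F z ^ q ∂π) ^ (1 / q) * (∫⁻ z, edist z.1 z.2 ^ p ∂π) ^ (1 / p) :=
        ENNReal.lintegral_mul_le_Lp_mul_Lq π hpq.symm hFm.aemeasurable (by fun_prop)
    _ ≤ _ := by
        gcongr
        exact one_div_nonneg.2 hpq.symm.nonneg

/-- A functional with the subgradient `g` at `ν₀` has descending slope at most the `L^q` norm of
the local Lipschitz constant of `g`. -/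
theorem descendingSlope_rpow_le {M : Type*} [MetricSpace M] [MeasurableSpace M]
    [SecondCountableTopology M] [BorelSpace M] {p q : ℝ} (hpq : p.HolderConjugate q)
    {g : M → ℝ} {L : ℝ≥0} (hg : LipschitzWith L g) (Φ : WassersteinSpace M p → EReal)
    (ν₀ : WassersteinSpace M p) (htop : Φ ν₀ ≠ ⊤) (hbot : Φ ν₀ ≠ ⊥)
    (hint : ∀ ν : WassersteinSpace M p, Integrable g ν.1)
    (hΦ : ∀ ν : WassersteinSpace M p, (Φ ν₀ - Φ ν).toENNReal
      ≤ ENNReal.ofReal (∫ x, g x ∂ν₀.1 - ∫ x, g x ∂ν.1)) :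
    descendingSlope wassersteinDist Φ ν₀ ^ q
      ≤ ∫⁻ x, (⨅ n : ℕ, localDescent g ((n : ℝ≥0∞) + 1)⁻¹ x) ^ q ∂ν₀.1 := by
  have := ν₀.2.1
  have hp := hpq.pos
  have hq := hpq.symm.pos
  have hbound : ∀ δ : ℝ≥0∞, ∫⁻ x, localDescent g δ x ^ q ∂ν₀.1 ≤ (L : ℝ≥0∞) ^ q := fun δ => by
    refine (lintegral_mono fun x => ENNReal.rpow_le_rpow (localDescent_le hg δ x) hq.le).trans ?_
    simp
  have hLtop : (L : ℝ≥0∞) ^ q ≠ ∞ := ENNReal.rpow_ne_top_of_nonneg hq.le ENNReal.coe_ne_top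
  have hslope : ∀ δ : ℝ≥0∞, δ ≠ 0 → δ ≠ ∞ →
      descendingSlope wassersteinDist Φ ν₀ ^ q ≤ ∫⁻ x, localDescent g δ x ^ q ∂ν₀.1 := by
    intro δ hδ0 hδ
    refine ENNReal.le_of_forall_pos_le_add fun κ hκ _ => ?_
    have hκ' : (0 : ℝ≥0∞) < κ := by exact_mod_cast hκ
    -- `κ` leaves room for the far pairs and keeps `K` nonzero for the division below.
    set K : ℝ≥0∞ := (∫⁻ x, localDescent g δ x ^ q ∂ν₀.1 + κ) ^ (1 / q) with hK
    have hKtop : K ≠ ∞ := ENNReal.rpow_ne_top_of_nonneg (by positivity)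
      (ENNReal.add_ne_top.2 ⟨((hbound δ).trans_lt hLtop.lt_top).ne, ENNReal.coe_ne_top⟩)
    have hKpow : K ^ q = ∫⁻ x, localDescent g δ x ^ q ∂ν₀.1 + κ := by
      rw [hK, ← ENNReal.rpow_mul, one_div_mul_cancel hq.ne', ENNReal.rpow_one]
    have hK0 : K ≠ 0 := by
      intro h0
      rw [h0, ENNReal.zero_rpow_of_pos hq] at hKpow
      exact (hκ'.trans_le le_add_self).ne hKpow
    rw [← hKpow]
    refine ENNReal.rpow_le_rpow ?_ hq.le
    rw [descendingSlope, if_pos ⟨htop, hbot⟩]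
    have hsmall : ∀ᶠ c : ℝ≥0∞ in 𝓝 0, (L : ℝ≥0∞) ^ q * (c ^ p / δ ^ p) < κ := by
      have ht : Tendsto (fun c : ℝ≥0∞ => (L : ℝ≥0∞) ^ q * (c ^ p / δ ^ p)) (𝓝 0) (𝓝 0) := by
        have h1 : Tendsto (fun c : ℝ≥0∞ => c ^ p) (𝓝 0) (𝓝 0) := by
          simpa [hp] using (ENNReal.continuous_rpow_const (y := p)).tendsto 0
        have h2 := ENNReal.Tendsto.div_const h1 (b := δ ^ p)
          (Or.inr (ENNReal.rpow_pos (pos_iff_ne_zero.2 hδ0) hδ).ne')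
        simpa using ENNReal.Tendsto.const_mul h2 (Or.inr hLtop)
      exact ht.eventually (gt_mem_nhds hκ')
    obtain ⟨θ, hθ, hθκ⟩ := ENNReal.nhds_zero_basis.eventually_iff.1 hsmall
    have hmem : ∀ᶠ ν in puncturedNhds wassersteinDist ν₀, wassersteinDist ν ν₀ < θ :=
      (tendsto_comap.mono_left inf_le_left).eventually (gt_mem_nhds hθ)
    refine limsup_le_of_le (h := ?_)
    filter_upwards [hmem] with ν hνθ
    refine ENNReal.div_le_of_le_mul ((hΦ ν).trans ?_)
    rw [← ENNReal.div_le_iff' hK0 hKtop]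
    -- If the bound failed, some coupling would have cost below both `θ` and the quotient; no
    -- optimal plan is needed.
    by_contra! hlt
    have hlt' := lt_min hνθ hlt
    rw [wassersteinDist] at hlt'
    simp only [iInf_lt_iff] at hlt'
    obtain ⟨π, hπ, hc⟩ := hlt'
    have hcost : ((∫⁻ z, edist z.1 z.2 ^ p ∂π) ^ (1 / p)) ^ p = ∫⁻ z, edist z.1 z.2 ^ p ∂π := by
      rw [← ENNReal.rpow_mul, one_div_mul_cancel hp.ne', ENNReal.rpow_one]
    have hκπ := hθκ (hc.trans_le (min_le_left _ _))
    simp only [hcost] at hκπ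
    refine (hc.trans_le (min_le_right _ _)).not_ge ?_
    rw [ENNReal.div_le_iff' hK0 hKtop]
    refine (ofReal_integral_sub_le hpq hπ hg (hint ν) (hint ν₀) hδ0 hδ).trans ?_
    rw [hK]
    gcongr
  have hδanti : Antitone fun n : ℕ => ((n : ℝ≥0∞) + 1)⁻¹ := fun m n h =>
    ENNReal.inv_le_inv.2 (by gcongr)
  have hpow : ∀ x, (⨅ n : ℕ, localDescent g ((n : ℝ≥0∞) + 1)⁻¹ x) ^ q
      = ⨅ n : ℕ, localDescent g ((n : ℝ≥0∞) + 1)⁻¹ x ^ q := fun x =>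
    (ENNReal.orderIsoRpow q hq).map_iInf _
  simp_rw [hpow]
  -- Monotone convergence from above, finite because of the bound `L^q`.
  rw [lintegral_iInf (fun n => (measurable_localDescent hg.continuous _).pow_const q)
    (fun m n h x => ENNReal.rpow_le_rpow (localDescent_mono g x (hδanti h)) hq.le)
    ((hbound _).trans_lt hLtop.lt_top).ne]
  exact le_iInf fun n => hslope _ (by simp) (by simp)

end RenyiSlope

end

/-! ### The Rényi entropy. -/

theorem mainTheorem6 {M : Type*} [MetricSpace M] [LocallyCompactSpace M]
    [SecondCountableTopology M] [MeasurableSpace M] [BorelSpace M]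
    (μ : Measure M) [IsFiniteMeasure μ]
    (p q r : ℝ) (hpq : p.HolderConjugate q) (hp2 : p ≠ 2)
    (hr : r = 1 - (p - 1) / q) (hr0 : 0 < r)
    (hreg : 2 < p → CompactSpace M ∧
      ∃ n : ℝ, 0 < n ∧ n * (p - 2) < 1 ∧ RenyiSlope.IsAhlforsRegular μ n)
    (ρ : M → ℝ) (hLip : ∃ K : ℝ≥0, LipschitzWith K ρ) (hbdd : ∃ C : ℝ, ∀ x, ρ x ≤ C)
    (ε : ℝ) (hε : 0 < ε) (hρ : ∀ x, ε ≤ ρ x)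
    (μ₀ : RenyiSlope.WassersteinSpace M p)
    (hμ₀ : μ₀.1 = μ.withDensity (fun x => ENNReal.ofReal (ρ x)))
    (hdom : RenyiSlope.renyiEntropy p μ μ₀ < ⊤) :
    RenyiSlope.descendingSlope RenyiSlope.wassersteinDist (RenyiSlope.renyiEntropy p μ) μ₀ ^ q
        ≤ ∫⁻ x, RenyiSlope.localLip ρ x ^ q / ENNReal.ofReal (ρ x ^ (p - 1)) ∂μ ∧
      ∫⁻ x, RenyiSlope.localLip ρ x ^ q / ENNReal.ofReal (ρ x ^ (p - 1)) ∂μ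
        = ENNReal.ofReal (r ^ (-q)) *
            ∫⁻ x, RenyiSlope.localLip (fun y => ρ y ^ r) x ^ q ∂μ := by
  open RenyiSlope in
  obtain ⟨K, hK⟩ := hLip
  obtain ⟨C, hC⟩ := hbdd
  have hp1 : 1 < p := hpq.lt
  have hq := hpq.symm.pos
  have hpos : ∀ x, 0 < ρ x := fun x => hε.trans_le (hρ x)
  -- `r > 0` means `p² - 3p + 1 < 0`.
  have hp3 : p < 3 := by
    have hq' : (p - 1) / q = (p - 1) ^ 2 / p := by
      rw [hpq.conjugate_eq]
      have : p - 1 ≠ 0 := by linarith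
      field_simp
    rw [hr, hq', sub_pos, div_lt_one hpq.pos] at hr0
    nlinarith
  refine ⟨?_, lintegral_localLip_rpow μ hpq hr hr0 hK.continuous hpos⟩
  have hρm : Measurable ρ := hK.continuous.measurable
  have hfin : ∀ ν : WassersteinSpace M p, IsFiniteMeasure ν.1 := fun ν =>
    have := ν.2.1
    inferInstance
  have hsub := fun ν : WassersteinSpace M p => have := hfin ν
    entropyFunctional_ge (ν := ν.1) (μ := μ) hρm (measurable_renyiDeriv p) (measurable_renyiFun p)
    hε hρ hC (fun t s ht hs => renyiFun_ge_tangent hp3 hp2 ht hs) (monotoneOn_renyiDeriv hp3 hp2)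
  have hval : renyiEntropy p μ μ₀ = ((∫ x, renyiFun p (ρ x) ∂μ : ℝ) : EReal) := by
    rw [renyiEntropy, hμ₀]
    exact entropyFunctional_withDensity hρm (fun x => (hpos x).le) (hsub μ₀).2.1
  have hgL : LipschitzWith ((ε ^ (1 - p)).toNNReal * K) fun x => renyiDeriv p (ρ x) := by
    have h := (lipschitzOnWith_renyiDeriv hp1 hp3 hp2 hε).comp (hK.lipschitzOnWith (s := Set.univ))
      (fun x _ => hρ x)
    exact lipschitzOnWith_univ.1 h
  refine (descendingSlope_rpow_le hpq hgL _ μ₀ (by simp [hval]) (by simp [hval])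
    (fun ν => (hsub ν).1) fun ν => ?_).trans ?_
  · rw [hval, ← EReal.real_coe_toENNReal, hμ₀]
    refine EReal.toENNReal_le_toENNReal ((EReal.sub_le_sub le_rfl (hsub ν).2.2).trans ?_)
    rw [← EReal.coe_sub, EReal.coe_le_coe_iff]
    linarith
  · rw [hμ₀]
    -- The one-sided inequality needs measurability of the density only.
    refine (lintegral_withDensity_le_lintegral_mul μ hρm.ennreal_ofReal _).trans
      (lintegral_mono fun x => ?_)
    have hx := hpos x
    have h1 : (⨅ n : ℕ, localDescent (fun x => renyiDeriv p (ρ x)) ((n : ℝ≥0∞) + 1)⁻¹ x) ^ q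
        ≤ ENNReal.ofReal (ρ x ^ (1 - p)) ^ q * localLip ρ x ^ q := by
      rw [← ENNReal.mul_rpow_of_nonneg _ _ hq.le]
      exact ENNReal.rpow_le_rpow ((iInf_localDescent_le _ x).trans
        (localLip_comp_le hK.continuous.continuousAt (hasDerivAt_renyiDeriv hp3 hp2 hx)
          (by positivity))) hq.le
    rw [Pi.mul_apply]
    refine (mul_le_mul_right h1 _).trans_eq ?_
    rw [ENNReal.ofReal_rpow_of_pos (by positivity), ← mul_assoc,
      ← ENNReal.ofReal_mul hx.le, mul_comm, div_eq_mul_inv,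
      ← ENNReal.ofReal_inv_of_pos (by positivity), ← Real.rpow_mul hx.le, ← Real.rpow_neg hx.le,
      mul_comm (ρ x), ← Real.rpow_add_one hx.ne']
    -- The exponents agree: `(1 - p) q + 1 = -(p - 1)`.
    congr 3
    linarith [hpq.mul_eq_add]
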